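/- Let $E$ be a (real) Banach lattice with positive cone $E^+$ and topological dual $E'$; let $(E')^+$ be the set of positive functionals in $E'$. A net $(x_\alpha)$ in $E$ is uaw-convergent to $x\in E$ if $|x_\alpha-x|\wedge w\to 0$ weakly for every $w\in E^+$, and uaw-null if it is uaw-convergent to $0$. A norm bounded set $A\subset E$ is uaw-compact (resp. relatively uaw-compact) if every net in $A$ has a subnet that is uaw-convergent to an element of $A$ (resp. of $E$). For $A\subset E$ let $\mathrm{sol}(A)=\{x\in E:\ |x|\le |y| \text{ for some } y\in A\}$. A norm bounded set $A\subset E$ is L-weakly compact if every disjoint sequence in $\mathrm{sol}(A)$ is norm null. For a norm bounded set $\mathcal S\subset E$, a bounded operator $T$ from $E$ to a Banach space is $\mathcal S$-L-weakly compact if $\|Tx_n\|\to0$ for every uaw-null sequence $(x_n)$ in $\mathrm{sol}(\mathcal S)$. Finally, $E$ is order continuous if every decreasing net in $E$ with infimum $0$ is norm null. The following statements are equivalent: 1. $E$ is order continuous. 2. Every relatively compact subset of $E$ is L-weakly compact. 3. For every $v\in E^+$, the identity operator $\mathrm{Id}_E$ is $\{v\}$-L-weakly compact. 4. For every $\varepsilon>0$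 and $v\in E^+$ there exist $g\in (E')^+$ and $w\in E^+$ such that $\|x\|\le g(|x|\wedge w)+\varepsilon$ for all $x\in[-v,v]$. 5. For every $v\in E^+$, every uaw-null net in $[-v,v]$ is norm null. 6. For every $v\in E^+$, every uaw-null sequence in $[-v,v]$ is norm null. 7. Every order bounded uaw-compact subset of $E$ is compact. 8. Every order bounded relatively uaw-compact subset of $E$ is relatively compact. -/

import Mathlib

open Filter Topology

universe u

section UAWDefinitions

universe v

/-- Order continuity of a Banach lattice: every net decreasing to `0` (decreasing, with infimum
`0`) is norm null. The index sets range over the universe of `E`; since only the decreasing,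
downward directed set of values matters, this covers all nets. -/
def IsOrderContinuousLattice (E : Type u) [NormedAddCommGroup E] [Lattice E] : Prop :=
  ∀ (ι : Type u) [Preorder ι] [IsDirectedOrder ι] [Nonempty ι] (x : ι → E),
    Antitone x → IsGLB (Set.range x) 0 → Tendsto x atTop (𝓝 0)

variable {E : Type u} [NormedAddCommGroup E] [NormedSpace ℝ E] [Lattice E]

/-- Unbounded absolute weak convergence of the net `x` to `a`: for every `w ≥ 0`, the net
`|x i - a| ⊓ w` converges weakly to `0`, i.e. tested against every continuous functional. -/
def UAWTendsto {ι : Type v} [Preorder ι] (x : ι → E) (a : E) : Prop :=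
  ∀ w : E, 0 ≤ w → ∀ f : StrongDual ℝ E, Tendsto (fun i => f (|x i - a| ⊓ w)) atTop (𝓝 0)

/-- `A` is L-weakly compact: it is norm bounded and every disjoint sequence in its solid hull is
norm null. -/
def IsLWeaklyCompact (A : Set E) : Prop :=
  Bornology.IsBounded A ∧
    ∀ x : ℕ → E, (∀ n, x n ∈ LatticeOrderedAddCommGroup.solidClosure A) →
      (∀ m n, m ≠ n → |x m| ⊓ |x n| = 0) → Tendsto x atTop (𝓝 0)

/-- The operator `T` is `S`-L-weakly compact (for a norm bounded set `S`): it maps uaw-null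
sequences in the solid hull of `S` to norm
null sequences. -/
def IsLwcOperator {Y : Type v} [NormedAddCommGroup Y] [NormedSpace ℝ Y]
    (S : Set E) (T : E →L[ℝ] Y) : Prop :=
  ∀ x : ℕ → E, (∀ n, x n ∈ LatticeOrderedAddCommGroup.solidClosure S) →
    UAWTendsto x 0 → Tendsto (fun n => T (x n)) atTop (𝓝 0)

/-- The net `x` has a subnet that is uaw-convergent to `a`. A subnet of `x : ι → E` is `x ∘ φ` for
a map `φ : κ → ι` from a directed set `κ` that eventually exceeds every index. -/
def HasUAWConvergentSubnet {ι : Type u} [Preorder ι] (x : ι → E) (a : E) : Prop :=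
  ∃ (κ : Type u) (_ : Preorder κ) (_ : IsDirectedOrder κ) (_ : Nonempty κ) (φ : κ → ι),
    Tendsto φ atTop atTop ∧ UAWTendsto (x ∘ φ) a

/-- The norm bounded set `A` is uaw-compact: every net in `A` has a subnet that is uaw-convergent
to an element of `A`. -/
def IsUAWCompact (A : Set E) : Prop :=
  Bornology.IsBounded A ∧
    ∀ (ι : Type u) [Preorder ι] [IsDirectedOrder ι] [Nonempty ι] (x : ι → E),
      (∀ i, x i ∈ A) → ∃ a ∈ A, HasUAWConvergentSubnet x a

/-- The norm bounded set `A` is relatively uaw-compact: every net in `A` has a subnet that is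
uaw-convergent to an element of the whole space. -/
def IsRelativelyUAWCompact (A : Set E) : Prop :=
  Bornology.IsBounded A ∧
    ∀ (ι : Type u) [Preorder ι] [IsDirectedOrder ι] [Nonempty ι] (x : ι → E),
      (∀ i, x i ∈ A) → ∃ a : E, HasUAWConvergentSubnet x a

end UAWDefinitions

/-!
Everything is equivalent to the condition that disjoint sequences in order intervals are norm null.

Given this condition, a sequence `z ≥ 0` whose partial sums stay below `v` is norm null: the
elements `(z n - c • ∑ i ∈ Ico p q, z i - c⁻¹ • v)⁺` of sparse blocks are pairwise disjoint, so they
are eventually small, and adding `c ^ 2` consecutive blocks gives `‖z n‖ ≲ 2 * ‖v‖ / c`. Monotone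
order bounded nets are then Cauchy, and in a complete lattice this is order continuity. Conversely,
the partial sums of a disjoint sequence in `[0, v]` increase and stay below `v`; the differences
between upper bounds and partial sums form a downward directed set with infimum `0`.

Disjoint sequences are uaw-null, so every uaw condition implies the condition on disjoint sequences.
For the converse it suffices to dominate the norm on `[0, v]` by a positive functional up to `ε`.
If no functional does so, one picks inductively `x n ∈ [0, v]` of norm above `ε` on which the
norming positive functionals of the previous elements are so small that each of them is summable
along `x`, hence nonpositive at the order limsup `a` of `x`. The suprema of the tails of `x`
converge to `a` in norm, so the norming functional of `x n` is asymptotically nonpositive at `x n`,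
a contradiction.
-/

section LatticeGroup

theorem inf_eq_zero_of_le_of_le {L : Type*} [Lattice L] [Zero L] {a b c d : L} (ha : 0 ≤ a)
    (hb : 0 ≤ b) (hac : a ≤ c) (hbd : b ≤ d) (h : c ⊓ d = 0) : a ⊓ b = 0 :=
  le_antisymm (h ▸ inf_le_inf hac hbd) (le_inf ha hb)

theorem posPart_smul_of_pos {M : Type*} [AddCommGroup M] [Lattice M] [Module ℝ M]
    [IsOrderedModule ℝ M] {r : ℝ} (hr : 0 < r) (a : M) : (r • a)⁺ = r • a⁺ := by
  have h := (OrderIso.smulRight (β := M) hr).map_sup a 0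
  rw [OrderIso.smulRight_apply, OrderIso.smulRight_apply, OrderIso.smulRight_apply,
    smul_zero] at h
  exact h.symm

variable {G : Type*} [AddCommGroup G] [Lattice G] [IsOrderedAddMonoid G] {a b c w : G}

theorem inf_add_eq_zero (ha : 0 ≤ a) (hb : 0 ≤ b) (hc : 0 ≤ c) (hab : a ⊓ b = 0)
    (hac : a ⊓ c = 0) : a ⊓ (b + c) = 0 := by
  refine le_antisymm (hac ▸ le_inf inf_le_left ?_) (le_inf ha (add_nonneg hb hc))
  have h : a ⊓ (b + c) - c ≤ a ⊓ b :=
    le_inf ((sub_le_self _ hc).trans inf_le_left) (sub_le_iff_le_add.2 inf_le_right)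
  exact sub_nonpos.1 (h.trans_eq hab)

theorem inf_sum_eq_zero {ι : Type*} {y : ι → G} {s : Finset ι} (ha : 0 ≤ a) (hy : ∀ i, 0 ≤ y i)
    (h : ∀ i ∈ s, a ⊓ y i = 0) : a ⊓ ∑ i ∈ s, y i = 0 := by
  classical
  induction s using Finset.induction_on with
  | empty => simpa using ha
  | insert j s hj ih =>
    rw [Finset.forall_mem_insert] at h
    rw [Finset.sum_insert hj]
    exact inf_add_eq_zero ha (hy j) (Finset.sum_nonneg fun i _ => hy i) h.1 (ih h.2)

theorem sum_le_of_pairwise_inf_eq_zero {ι : Type*} {y : ι → G} (hy : ∀ i, y i ∈ Set.Icc 0 w)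
    (h : Pairwise fun i j => y i ⊓ y j = 0) (hw : 0 ≤ w) (s : Finset ι) : ∑ i ∈ s, y i ≤ w := by
  classical
  induction s using Finset.induction_on with
  | empty => simpa using hw
  | insert j s hj ih =>
    have hdisj : y j ⊓ ∑ i ∈ s, y i = 0 :=
      inf_sum_eq_zero (hy j).1 (fun i => (hy i).1) fun i hi => h (ne_of_mem_of_not_mem hi hj).symm
    rw [Finset.sum_insert hj, ← inf_add_sup (y j), hdisj, zero_add]
    exact sup_le (hy j).2 ih

theorem partialSups_le_sum_range_succ {y : ℕ → G} (hy : ∀ n, 0 ≤ y n) (m : ℕ) :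
    partialSups y m ≤ ∑ k ∈ Finset.range (m + 1), y k :=
  partialSups_le _ _ _ fun _ hk =>
    Finset.single_le_sum (fun i _ => hy i) (Finset.mem_range_succ_iff.2 hk)

theorem abs_le_iff_mem_Icc : |a| ≤ w ↔ a ∈ Set.Icc (-w) w := by
  rw [abs_le', Set.mem_Icc, neg_le, and_comm]

theorem solidClosure_singleton (hw : 0 ≤ w) :
    LatticeOrderedAddCommGroup.solidClosure {w} = Set.Icc (-w) w := by
  ext x
  simpa [LatticeOrderedAddCommGroup.solidClosure, abs_of_nonneg hw] using abs_le_iff_mem_Icc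

variable [Module ℝ G] [IsOrderedModule ℝ G] {r : ℝ}

theorem inf_smul_eq_zero (hr : 0 < r) (ha : 0 ≤ a) (hb : 0 ≤ b) (h : a ⊓ b = 0) :
    a ⊓ r • b = 0 := by
  have hr' : 0 < max 1 r := zero_lt_one.trans_le (le_max_left _ _)
  refine inf_eq_zero_of_le_of_le ha (smul_nonneg hr.le hb)
    (le_smul_of_one_le_left ha (le_max_left 1 r))
    (smul_le_smul_of_nonneg_right (le_max_right 1 r) hb) ?_
  simpa [h] using ((OrderIso.smulRight (β := G) hr').map_inf a b).symm

theorem posPart_sub_inv_smul_inf_posPart_sub_smul (hr : 0 < r) (a b : G) :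
    (a - r⁻¹ • b)⁺ ⊓ (b - r • a)⁺ = 0 := by
  have h : b - r • a = r • -(a - r⁻¹ • b) := by rw [neg_sub, smul_sub, smul_inv_smul₀ hr.ne']
  rw [h, posPart_smul_of_pos hr, posPart_neg]
  exact inf_smul_eq_zero hr (posPart_nonneg _) (negPart_nonneg _) (posPart_inf_negPart_eq_zero _)

end LatticeGroup

section SolidNorm

variable {E : Type*} [NormedAddCommGroup E] [Lattice E] [IsOrderedAddMonoid E] [HasSolidNorm E]
  {a b : E}

theorem norm_le_norm_of_nonneg_of_le (ha : 0 ≤ a) (hab : a ≤ b) : ‖a‖ ≤ ‖b‖ :=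
  norm_le_norm_of_abs_le_abs (abs_le_abs_of_nonneg ha hab)

theorem norm_posPart_le_norm (a : E) : ‖a⁺‖ ≤ ‖a‖ :=
  (norm_le_norm_of_nonneg_of_le (posPart_nonneg a) (sup_le (le_abs_self a) (abs_nonneg a))).trans_eq
    (norm_abs_eq_norm a)

theorem norm_posPart_add_le (a b : E) : ‖(a + b)⁺‖ ≤ ‖a⁺‖ + ‖b⁺‖ :=
  (norm_le_norm_of_nonneg_of_le (posPart_nonneg _) (sup_le
    (add_le_add (le_posPart a) (le_posPart b))
    (add_nonneg (posPart_nonneg a) (posPart_nonneg b)))).trans (norm_add_le _ _)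

theorem norm_le_norm_add_norm_posPart_sub (ha : 0 ≤ a) (b : E) : ‖a‖ ≤ ‖b‖ + ‖(a - b)⁺‖ :=
  (norm_le_norm_of_nonneg_of_le ha (sub_le_iff_le_add'.1 (le_posPart (a - b)))).trans
    (norm_add_le _ _)

theorem nonpos_of_forall_nsmul_le [NormedSpace ℝ E] [IsOrderedModule ℝ E]
    (h : ∀ n : ℕ, n • a ≤ b) : a ≤ 0 := by
  have hle (n : ℕ) : a ≤ ((n : ℝ) + 1)⁻¹ • b := by
    rw [le_inv_smul_iff_of_pos (by positivity)]
    exact_mod_cast (Nat.cast_smul_eq_nsmul ℝ (n + 1) a).trans_le (h (n + 1))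
  have hlim : Tendsto (fun n : ℕ => ((n : ℝ) + 1)⁻¹ • b) atTop (𝓝 0) := by
    simpa [one_div] using (tendsto_one_div_add_atTop_nhds_zero_nat (𝕜 := ℝ)).smul_const b
  exact ge_of_tendsto' hlim hle

end SolidNorm

section OrderBoundedMonotone

variable {E : Type u} [NormedAddCommGroup E] [Lattice E] [IsOrderedAddMonoid E]
  {v : E}

theorem IsLWeaklyCompact.tendsto_zero_of_pairwise_inf_eq_zero (H : IsLWeaklyCompact {v})
    {x : ℕ → E} (hx : ∀ n, x n ∈ Set.Icc 0 v) (hd : ∀ m n, m < n → x m ⊓ x n = 0) :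
    Tendsto x atTop (𝓝 0) := by
  refine H.2 x (fun n => ⟨v, rfl, abs_le_abs_of_nonneg (hx n).1 (hx n).2⟩) fun m n hmn => ?_
  rw [abs_of_nonneg (hx m).1, abs_of_nonneg (hx n).1]
  exact hmn.lt_or_gt.elim (hd m n) fun h => (inf_comm _ _).trans (hd n m h)

variable [NormedSpace ℝ E] [IsOrderedModule ℝ E] {z : ℕ → E}

theorem IsLWeaklyCompact.exists_forall_norm_posPart_sub_sum_le (H : IsLWeaklyCompact {v})
    (hz : ∀ n, 0 ≤ z n) (hzv : ∀ n, ∑ i ∈ Finset.range n, z i ≤ v) {c ε : ℝ} (hc : 0 < c)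
    (hε : 0 < ε) (p : ℕ) :
    ∃ q ≥ p, ∀ n ≥ q, ‖(z n - c • ∑ i ∈ Finset.Ico p q, z i - c⁻¹ • v)⁺‖ ≤ ε := by
  by_contra! hcon
  have hv : 0 ≤ c⁻¹ • v := smul_nonneg (inv_nonneg.2 hc.le) (by simpa using hzv 0)
  have hz_le (n : ℕ) : z n ≤ v :=
    (Finset.single_le_sum (fun i _ => hz i) (Finset.self_mem_range_succ n)).trans (hzv (n + 1))
  let y (k : ℕ × ℕ) : E := (z k.2 - c • ∑ i ∈ Finset.Ico p k.1, z i - c⁻¹ • v)⁺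
  have hsum (q : ℕ) : 0 ≤ c • ∑ i ∈ Finset.Ico p q, z i :=
    smul_nonneg hc.le (Finset.sum_nonneg fun i _ => hz i)
  obtain ⟨k, hk, hk_lt⟩ : ∃ k : ℕ → ℕ × ℕ,
      (∀ r, p ≤ (k r).1 ∧ (k r).1 ≤ (k r).2 ∧ ε < ‖y (k r)‖) ∧
      ∀ r s, r < s → (k r).2 < (k s).1 := by
    refine exists_seq_of_forall_finset_exists
      (fun k : ℕ × ℕ => p ≤ k.1 ∧ k.1 ≤ k.2 ∧ ε < ‖y k‖) (fun k l => k.2 < l.1) fun s _ => ?_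
    obtain ⟨n, hn, hbig⟩ := hcon (max p (s.sup Prod.snd + 1)) (le_max_left _ _)
    exact ⟨(_, n), ⟨le_max_left _ _, hn, hbig⟩, fun k hks =>
      (Nat.lt_succ_of_le (Finset.le_sup (f := Prod.snd) hks)).trans_le (le_max_right _ _)⟩
  have hy_mem (r : ℕ) : y (k r) ∈ Set.Icc 0 v := by
    refine ⟨posPart_nonneg _, sup_le ?_ ((hz 0).trans (hz_le 0))⟩
    exact ((sub_le_self _ hv).trans (sub_le_self _ (hsum _))).trans (hz_le _)
  have hy_disj (r s : ℕ) (hrs : r < s) : y (k r) ⊓ y (k s) = 0 := by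
    have hmem : (k r).2 ∈ Finset.Ico p (k s).1 :=
      Finset.mem_Ico.2 ⟨(hk r).1.trans (hk r).2.1, hk_lt r s hrs⟩
    refine inf_eq_zero_of_le_of_le (posPart_nonneg _) (posPart_nonneg _) (posPart_mono ?_)
      (posPart_mono ?_) (posPart_sub_inv_smul_inf_posPart_sub_smul hc (z (k r).2) (z (k s).2))
    · exact sub_le_sub (sub_le_self _ (hsum _))
        (smul_le_smul_of_nonneg_left (hz_le _) (inv_nonneg.2 hc.le))
    · exact (sub_le_self _ hv).trans (sub_le_sub_left (smul_le_smul_of_nonneg_left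
        (Finset.single_le_sum (fun i _ => hz i) hmem) hc.le) _)
  have hlim := (H.tendsto_zero_of_pairwise_inf_eq_zero hy_mem hy_disj).norm
  rw [norm_zero] at hlim
  exact hε.not_ge (ge_of_tendsto' hlim fun r => (hk r).2.2.le)

variable [HasSolidNorm E]

theorem IsLWeaklyCompact.exists_forall_norm_posPart_smul_sub_sum_le (H : IsLWeaklyCompact {v})
    (hz : ∀ n, 0 ≤ z n) (hzv : ∀ n, ∑ i ∈ Finset.range n, z i ≤ v) {c ε : ℝ} (hc : 0 < c)
    (hε : 0 < ε) (N : ℕ) :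
    ∃ q, ∀ n ≥ q,
      ‖((N : ℝ) • z n - c • ∑ i ∈ Finset.range q, z i - ((N : ℝ) * c⁻¹) • v)⁺‖ ≤ N * ε := by
  induction N with
  | zero => exact ⟨0, by simp⟩
  | succ N ih =>
    obtain ⟨p, hp⟩ := ih
    obtain ⟨q, hpq, hq⟩ := H.exists_forall_norm_posPart_sub_sum_le hz hzv hc hε p
    refine ⟨q, fun n hn => ?_⟩
    have hsplit : ((N + 1 : ℕ) : ℝ) • z n - c • ∑ i ∈ Finset.range q, z i
          - (((N + 1 : ℕ) : ℝ) * c⁻¹) • v =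
        ((N : ℝ) • z n - c • ∑ i ∈ Finset.range p, z i - ((N : ℝ) * c⁻¹) • v)
          + (z n - c • ∑ i ∈ Finset.Ico p q, z i - c⁻¹ • v) := by
      rw [← Finset.sum_range_add_sum_Ico z hpq]
      push_cast
      module
    calc _ ≤ N * ε + ε := by
          rw [hsplit]
          exact (norm_posPart_add_le _ _).trans (add_le_add (hp n (hpq.trans hn)) (hq n hn))
      _ = ((N + 1 : ℕ) : ℝ) * ε := by push_cast; ring

theorem IsLWeaklyCompact.tendsto_zero_of_sum_le (H : IsLWeaklyCompact {v}) (hz : ∀ n, 0 ≤ z n)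
    (hzv : ∀ n, ∑ i ∈ Finset.range n, z i ≤ v) : Tendsto z atTop (𝓝 0) := by
  -- For `N = c ^ 2` both error terms, `c • ∑ i, z i` and `(N * c⁻¹) • v`, have norm at most
  -- `c * ‖v‖`, which is negligible against `N`.
  have hbound (c : ℕ) (hc : (0 : ℝ) < c) : ∀ᶠ n in atTop, ‖z n‖ ≤ (2 * ‖v‖ + 1) / c := by
    obtain ⟨q, hq⟩ :=
      H.exists_forall_norm_posPart_smul_sub_sum_le hz hzv hc (inv_pos.2 hc) (c ^ 2)
    have hcc : (c : ℝ) ^ 2 * (c : ℝ)⁻¹ = c := by field_simp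
    filter_upwards [eventually_ge_atTop q] with n hn
    have hq' := hq n hn
    simp only [Nat.cast_pow, hcc, sub_sub] at hq'
    have hsum : ‖∑ i ∈ Finset.range q, z i‖ ≤ ‖v‖ :=
      norm_le_norm_of_nonneg_of_le (Finset.sum_nonneg fun i _ => hz i) (hzv q)
    have hscaled : (c : ℝ) ^ 2 * ‖z n‖ ≤ c * (2 * ‖v‖ + 1) := by
      calc (c : ℝ) ^ 2 * ‖z n‖ = ‖(c : ℝ) ^ 2 • z n‖ := (norm_smul_of_nonneg (sq_nonneg _) _).symm
        _ ≤ ‖(c : ℝ) • ∑ i ∈ Finset.range q, z i + (c : ℝ) • v‖ + c :=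
          (norm_le_norm_add_norm_posPart_sub (smul_nonneg (sq_nonneg _) (hz n)) _).trans
            (add_le_add_right hq' _)
        _ ≤ c * ‖v‖ + c * ‖v‖ + c := by
          refine add_le_add_left ((norm_add_le _ _).trans ?_) _
          rw [norm_smul_of_nonneg hc.le, norm_smul_of_nonneg hc.le]
          gcongr
        _ = c * (2 * ‖v‖ + 1) := by ring
    rw [le_div_iff₀ hc, ← mul_le_mul_iff_right₀ hc]
    linarith
  have hlim := tendsto_const_nhds (x := 2 * ‖v‖ + 1).div_atTop
    (tendsto_natCast_atTop_atTop (R := ℝ))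
  rw [Metric.tendsto_nhds]
  intro ε hε
  obtain ⟨c, hcε, hc⟩ :=
    ((hlim.eventually_lt_const hε).and (eventually_gt_atTop 0)).exists
  filter_upwards [hbound c (by exact_mod_cast hc)] with n hn
  rw [dist_zero_right]
  exact hn.trans_lt hcε

end OrderBoundedMonotone

section OrderContinuity

theorem cauchySeq_of_forall_exists_forall_ge_dist_lt {X ι : Type*} [PseudoMetricSpace X]
    [Preorder ι] [IsDirectedOrder ι] [Nonempty ι] {x : ι → X}
    (h : ∀ ε > 0, ∃ i, ∀ j ≥ i, dist (x j) (x i) < ε) : CauchySeq x := by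
  refine Metric.cauchy_iff.2 ⟨inferInstance, fun ε hε => ?_⟩
  obtain ⟨i, hi⟩ := h (ε / 2) (half_pos hε)
  refine ⟨x '' Set.Ici i, image_mem_map (Ici_mem_atTop i), ?_⟩
  rintro _ ⟨j, hj, rfl⟩ _ ⟨l, hl, rfl⟩
  linarith [dist_triangle_right (x j) (x l) (x i), hi j hj, hi l hl]

open scoped Pointwise

theorem directedOn_upperBounds_sub {G : Type*} [AddCommGroup G] [Lattice G]
    [IsOrderedAddMonoid G] {A : Set G} (hA : DirectedOn (· ≤ ·) A) :
    DirectedOn (· ≥ ·) (upperBounds A - A) := by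
  rintro _ ⟨y, hy, a, ha, rfl⟩ _ ⟨z, hz, b, hb, rfl⟩
  obtain ⟨c, hc, hac, hbc⟩ := hA a ha b hb
  exact ⟨y ⊓ z - c, Set.sub_mem_sub (fun _ hd => le_inf (hy hd) (hz hd)) hc,
    sub_le_sub inf_le_left hac, sub_le_sub inf_le_right hbc⟩

variable {E : Type u} [NormedAddCommGroup E] [Lattice E]

theorem IsOrderContinuousLattice.exists_norm_lt (H : IsOrderContinuousLattice E) {D : Set E}
    (hne : D.Nonempty) (hdir : DirectedOn (· ≥ ·) D) (hD : IsGLB D 0) {ε : ℝ} (hε : 0 < ε) :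
    ∃ d ∈ D, ‖d‖ < ε := by
  have : Nonempty (↥D)ᵒᵈ := hne.to_subtype
  have : IsDirectedOrder (↥D)ᵒᵈ := ⟨fun c d => by
    obtain ⟨b, hb, hbc, hbd⟩ := hdir c.ofDual c.ofDual.2 d.ofDual d.ofDual.2
    exact ⟨OrderDual.toDual ⟨b, hb⟩, hbc, hbd⟩⟩
  have hlim := H (↥D)ᵒᵈ (fun d => (d.ofDual : E)) (fun _ _ h => h)
    (by rwa [← show D = Set.range fun d : (↥D)ᵒᵈ => (d.ofDual : E) from Subtype.range_coe.symm])
  obtain ⟨d, hd⟩ := (hlim.eventually (Metric.ball_mem_nhds 0 hε)).exists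
  exact ⟨d.ofDual, d.ofDual.2, by rwa [dist_zero_right] at hd⟩

variable [IsOrderedAddMonoid E] [HasSolidNorm E] [NormedSpace ℝ E] [IsOrderedModule ℝ E] {v : E}

-- A lower bound `z` can be subtracted from an upper bound of `A` any number of times, so the
-- Archimedean property gives `z ≤ 0`.
theorem isGLB_upperBounds_sub {A : Set E} (hne : A.Nonempty) (hA : BddAbove A) :
    IsGLB (upperBounds A - A) 0 := by
  obtain ⟨a, ha⟩ := hne
  obtain ⟨u, hu⟩ := hA
  refine ⟨?_, fun z hz => ?_⟩
  · rintro _ ⟨y, hy, b, hb, rfl⟩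
    exact sub_nonneg.2 (hy hb)
  have hsub (n : ℕ) : u - n • z ∈ upperBounds A := by
    induction n with
    | zero => simpa using hu
    | succ n ih =>
      intro b hb
      rw [succ_nsmul, ← sub_sub]
      exact le_sub_comm.1 (hz (Set.sub_mem_sub ih hb))
  exact nonpos_of_forall_nsmul_le fun n => le_sub_comm.1 (hsub n ha)

theorem IsOrderContinuousLattice.isLWeaklyCompact_singleton (H : IsOrderContinuousLattice E)
    (hv : 0 ≤ v) : IsLWeaklyCompact {v} := by
  refine ⟨Bornology.isBounded_singleton, fun x hx hd => ?_⟩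
  rw [solidClosure_singleton hv] at hx
  let S (n : ℕ) : E := ∑ i ∈ Finset.range n, |x i|
  have hS : Monotone S := fun m n h =>
    Finset.sum_le_sum_of_subset_of_nonneg (Finset.range_mono h) fun i _ _ => abs_nonneg (x i)
  have hSv : v ∈ upperBounds (Set.range S) := by
    rintro _ ⟨n, rfl⟩
    exact sum_le_of_pairwise_inf_eq_zero
      (fun i => ⟨abs_nonneg _, abs_le_iff_mem_Icc.2 (hx i)⟩) (fun i j h => hd i j h) hv _
  rw [Metric.tendsto_atTop]
  intro ε hε
  obtain ⟨_, ⟨y, hy, _, ⟨N, rfl⟩, rfl⟩, hyN⟩ := H.exists_norm_lt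
    (Set.Nonempty.sub ⟨v, hSv⟩ (Set.range_nonempty S))
    (directedOn_upperBounds_sub hS.directed_le.directedOn_range)
    (isGLB_upperBounds_sub (Set.range_nonempty S) ⟨v, hSv⟩) hε
  refine ⟨N, fun n hn => ?_⟩
  have hxn : |x n| ≤ y - S N := by
    rw [← add_sub_cancel_left (S n) |x n|, ← Finset.sum_range_succ]
    exact sub_le_sub (hy (Set.mem_range_self (n + 1))) (hS hn)
  rw [dist_zero_right, ← norm_abs_eq_norm]
  exact (norm_le_norm_of_nonneg_of_le (abs_nonneg _) hxn).trans_lt hyN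

theorem IsLWeaklyCompact.cauchySeq_of_monotone (H : IsLWeaklyCompact {v}) {ι : Type*} [Preorder ι]
    [IsDirectedOrder ι] [Nonempty ι] {x : ι → E} (hx : Monotone x) (i₀ : ι)
    (hv : ∀ i, x i - x i₀ ≤ v) : CauchySeq x := by
  refine cauchySeq_of_forall_exists_forall_ge_dist_lt fun ε hε => ?_
  by_contra! hcon
  choose J hJ hJε using hcon
  let k (r : ℕ) : ι := J^[r] i₀
  have hk (r : ℕ) : k (r + 1) = J (k r) := Function.iterate_succ_apply' J r i₀
  have hlim := H.tendsto_zero_of_sum_le (z := fun r => x (k (r + 1)) - x (k r))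
    (fun r => sub_nonneg.2 (hx (hk r ▸ hJ (k r))))
    (fun n => (Finset.sum_range_sub (fun r => x (k r)) n).trans_le (hv (k n)))
  refine hε.not_ge (ge_of_tendsto' (b := ε) (by simpa using hlim.norm) fun r => ?_)
  rw [← dist_eq_norm, hk]
  exact hJε (k r)

theorem isOrderContinuousLattice_iff_forall_isLWeaklyCompact_singleton [CompleteSpace E] :
    IsOrderContinuousLattice E ↔ ∀ v : E, 0 ≤ v → IsLWeaklyCompact {v} := by
  refine ⟨fun H v => H.isLWeaklyCompact_singleton, fun H ι _ _ _ x hx hglb => ?_⟩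
  have hx0 (i : ι) : 0 ≤ x i := hglb.1 (Set.mem_range_self i)
  obtain ⟨i₀⟩ := ‹Nonempty ι›
  obtain ⟨a, ha⟩ := CompleteSpace.complete ((H (x i₀) (hx0 i₀)).cauchySeq_of_monotone hx.neg i₀
    fun i => by simpa using hx0 i)
  have hlim : Tendsto x atTop (𝓝 (-a)) := by simpa using Tendsto.neg (f := fun i => -x i) ha
  rwa [(isGLB_of_tendsto_atTop hx hlim).unique hglb] at hlim

end OrderContinuity

section TotallyBounded

variable {E : Type u} [NormedAddCommGroup E] [Lattice E] [IsOrderedAddMonoid E] [HasSolidNorm E]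

theorem isLWeaklyCompact_of_totallyBounded (H : ∀ v : E, 0 ≤ v → IsLWeaklyCompact {v}) {S : Set E}
    (hS : TotallyBounded S) : IsLWeaklyCompact S := by
  refine ⟨hS.isBounded, fun x hx hd => ?_⟩
  choose y hyS hxy using hx
  rw [Metric.tendsto_nhds]
  intro ε hε
  obtain ⟨t, ht, hSt⟩ := Metric.totallyBounded_iff.1 hS (ε / 2) (half_pos hε)
  let w : E := ∑ z ∈ ht.toFinset, |z|
  have hw : 0 ≤ w := Finset.sum_nonneg fun z _ => abs_nonneg z
  have hrest (n : ℕ) : ‖(|x n| - w)⁺‖ ≤ ε / 2 := by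
    obtain ⟨z, hz, hyz⟩ := Set.mem_iUnion₂.1 (hSt (hyS n))
    have hzw : |z| ≤ w := Finset.single_le_sum (f := fun z : E => |z|)
      (fun z _ => abs_nonneg z) (ht.mem_toFinset.2 hz)
    rw [Metric.mem_ball, dist_eq_norm, ← norm_abs_eq_norm] at hyz
    refine (norm_le_norm_of_nonneg_of_le (posPart_nonneg _) (sup_le ?_ (abs_nonneg _))).trans
      hyz.le
    calc |x n| - w ≤ |y n| - |z| := sub_le_sub (hxy n) hzw
      _ ≤ |y n - z| := sub_le_iff_le_add.2 (by simpa using abs_add_le (y n - z) z)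
  have hmem (n : ℕ) : |x n| ⊓ w ∈ Set.Icc 0 w := ⟨le_inf (abs_nonneg _) hw, inf_le_right⟩
  have hmain : Tendsto (fun n => |x n| ⊓ w) atTop (𝓝 0) :=
    (H w hw).tendsto_zero_of_pairwise_inf_eq_zero hmem fun m n hmn =>
      inf_eq_zero_of_le_of_le (hmem m).1 (hmem n).1 inf_le_left inf_le_left (hd m n hmn.ne)
  filter_upwards [Metric.tendsto_nhds.1 hmain (ε / 2) (half_pos hε)] with n hn
  rw [dist_zero_right] at hn ⊢
  calc ‖x n‖ = ‖|x n| ⊓ w + (|x n| - w)⁺‖ := by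
        rw [inf_eq_sub_posPart_sub, sub_add_cancel, norm_abs_eq_norm]
    _ ≤ ‖|x n| ⊓ w‖ + ‖(|x n| - w)⁺‖ := norm_add_le _ _
    _ < ε := by linarith [hrest n]

end TotallyBounded

section MonotoneFunctionals

variable {E : Type u} [NormedAddCommGroup E] [Lattice E] [IsOrderedAddMonoid E] [HasSolidNorm E]
  [NormedSpace ℝ E] {v : E}

theorem exists_lt_norm_forall_apply_le {ε c : ℝ} (hε : 0 ≤ ε)
    (h : ∀ g : StrongDual ℝ E, Monotone g → ∃ y ∈ Set.Icc 0 v, g y + ε < ‖y‖) {ι : Type*}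
    {s : Finset ι} {f : ι → StrongDual ℝ E} (hf : ∀ i ∈ s, Monotone (f i)) (hc : 0 < c) :
    ∃ y ∈ Set.Icc 0 v, ε < ‖y‖ ∧ ∀ i ∈ s, f i y ≤ ‖v‖ / c := by
  have happly (z : E) : (c • ∑ i ∈ s, f i) z = c * ∑ i ∈ s, f i z := by simp
  obtain ⟨y, hy, hgy⟩ := h (c • ∑ i ∈ s, f i) fun y z hyz => by
    rw [happly, happly]
    exact mul_le_mul_of_nonneg_left (Finset.sum_le_sum fun i hi => hf i hi hyz) hc.le
  have hfy (i : ι) (hi : i ∈ s) : 0 ≤ f i y := (map_zero (f i)).symm.trans_le (hf i hi hy.1)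
  have hsum : 0 ≤ c * ∑ i ∈ s, f i y := mul_nonneg hc.le (Finset.sum_nonneg hfy)
  rw [happly] at hgy
  refine ⟨y, hy, (le_add_of_nonneg_left hsum).trans_lt hgy, fun i hi => ?_⟩
  rw [le_div_iff₀' hc]
  calc c * f i y ≤ c * ∑ i ∈ s, f i y :=
        mul_le_mul_of_nonneg_left (Finset.single_le_sum hfy hi) hc.le
    _ ≤ ‖y‖ := by linarith
    _ ≤ ‖v‖ := norm_le_norm_of_nonneg_of_le hy.1 hy.2

variable [IsOrderedModule ℝ E]

-- Extending from `ℝ x` below the sublinear map `y ↦ ‖y⁺‖`, rather than `‖y‖`, forces positivity.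
theorem exists_monotone_dual_eq_norm {x : E} (hx : 0 ≤ x) :
    ∃ f : StrongDual ℝ E, Monotone f ∧ (∀ y, f y ≤ ‖y‖) ∧ f x = ‖x‖ := by
  let f₀ : E →ₗ.[ℝ] ℝ := LinearPMap.mkSpanSingleton' (σ := RingHom.id ℝ) x ‖x‖ fun c hc => by
    rcases smul_eq_zero.1 hc with rfl | rfl <;> simp
  have hf₀ (y : f₀.domain) : f₀ y ≤ ‖(y : E)⁺‖ := by
    obtain ⟨_, hy⟩ := y
    obtain ⟨c, rfl⟩ := Submodule.mem_span_singleton.1 hy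
    rw [LinearPMap.mkSpanSingleton'_apply, RingHom.id_apply, smul_eq_mul]
    rcases le_total c 0 with hc | hc
    · exact (mul_nonpos_of_nonpos_of_nonneg hc (norm_nonneg x)).trans (norm_nonneg _)
    · rw [posPart_of_nonneg (smul_nonneg hc hx), norm_smul_of_nonneg hc]
  obtain ⟨g, hg, hgN⟩ := exists_extension_of_le_sublinear f₀ (fun y => ‖y⁺‖)
    (fun c hc y => by rw [posPart_smul_of_pos hc, norm_smul_of_nonneg hc.le])
    norm_posPart_add_le hf₀
  have hle (y : E) : g y ≤ ‖y‖ := (hgN y).trans (norm_posPart_le_norm y)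
  refine ⟨g.mkContinuous 1 fun y => ?_, fun y z hyz => ?_, hle, ?_⟩
  · rw [one_mul, Real.norm_eq_abs]
    exact abs_le'.2 ⟨hle y, by simpa using hle (-y)⟩
  · have h := hgN (y - z)
    rw [map_sub, posPart_of_nonpos (sub_nonpos.2 hyz), norm_zero] at h
    exact sub_nonpos.1 h
  · exact (hg ⟨x, Submodule.mem_span_singleton_self x⟩).trans
      (LinearPMap.mkSpanSingleton'_apply_self _ _ _ _)

variable [CompleteSpace E] {x : ℕ → E}

-- `s n` is the supremum of the tail `x n, x (n + 1), …`, so `f (s n)` is at most the tail of the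
-- series `∑ k, f (x k)`; the limit `a` is the order limsup of `x`.
theorem IsLWeaklyCompact.exists_limsup_tails (H : IsLWeaklyCompact {v})
    (hx : ∀ n, x n ∈ Set.Icc 0 v) :
    ∃ (s : ℕ → E) (a : E), Tendsto s atTop (𝓝 a) ∧ (∀ n, x n ≤ s n) ∧
      ∀ f : StrongDual ℝ E, Monotone f → Summable (fun n => f (x n)) → f a ≤ 0 := by
  let p (n : ℕ) : ℕ →o E := partialSups fun k => x (k + n)
  have hxp {n m k : ℕ} (h : k ≤ m) : x (k + n) ≤ p n m :=
    le_partialSups_of_le (fun k => x (k + n)) h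
  have hpv (n m : ℕ) : p n m ≤ v := partialSups_le _ _ _ fun _ _ => (hx _).2
  have hp (n : ℕ) : ∃ s, Tendsto (p n) atTop (𝓝 s) :=
    cauchySeq_tendsto_of_complete <| H.cauchySeq_of_monotone (p n).monotone 0 fun m =>
      (sub_le_self _ ((hx _).1.trans (hxp le_rfl))).trans (hpv n m)
  choose s hs using hp
  have hxs (n k : ℕ) : x (k + n) ≤ s n :=
    (hxp le_rfl).trans ((p n).monotone.ge_of_tendsto (hs n) k)
  have hanti : Antitone s := antitone_nat_of_succ_le fun n =>
    le_of_tendsto' (hs (n + 1)) fun m => partialSups_le _ _ _ fun k _ => by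
      rw [← add_assoc, add_right_comm]
      exact hxs n (k + 1)
  obtain ⟨b, hb⟩ := cauchySeq_tendsto_of_complete <|
    H.cauchySeq_of_monotone hanti.neg 0 fun n => by
      rw [neg_sub_neg]
      exact (sub_le_self _ ((hx _).1.trans (hxs n 0))).trans (le_of_tendsto' (hs 0) (hpv 0))
  have hsa : Tendsto s atTop (𝓝 (-b)) := by simpa using hb.neg
  refine ⟨s, -b, hsa, fun n => by simpa using hxs n 0, fun f hf hsum => ?_⟩
  have hfs (n : ℕ) : f (s n) ≤ ∑' k, f (x (k + n)) := by
    refine le_of_tendsto' ((f.continuous.tendsto _).comp (hs n)) fun m => ?_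
    refine (hf (partialSups_le_sum_range_succ (fun k => (hx (k + n)).1) m)).trans ?_
    rw [map_sum]
    exact ((summable_nat_add_iff n).2 hsum).sum_le_tsum _
      fun k _ => (map_zero f).symm.trans_le (hf (hx (k + n)).1)
  exact le_of_tendsto_of_tendsto' ((f.continuous.tendsto _).comp hsa)
    (tendsto_sum_nat_add fun n => f (x n)) hfs

theorem IsLWeaklyCompact.tendsto_apply_zero (H : IsLWeaklyCompact {v})
    (hx : ∀ n, x n ∈ Set.Icc 0 v) {f : ℕ → StrongDual ℝ E} (hf : ∀ n, Monotone (f n))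
    (hf_le : ∀ n y, f n y ≤ ‖y‖) (hsum : ∀ n, Summable fun m => f n (x m)) :
    Tendsto (fun n => f n (x n)) atTop (𝓝 0) := by
  obtain ⟨s, a, hsa, hxs, ha⟩ := H.exists_limsup_tails hx
  refine squeeze_zero (fun n => (map_zero (f n)).symm.trans_le (hf n (hx n).1)) (fun n => ?_)
    (tendsto_iff_norm_sub_tendsto_zero.1 hsa)
  calc f n (x n) ≤ f n (s n) := hf n (hxs n)
    _ = f n (s n - a) + f n a := by rw [map_sub, sub_add_cancel]
    _ ≤ ‖s n - a‖ := by linarith [hf_le n (s n - a), ha (f n) (hf n) (hsum n)]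

theorem IsLWeaklyCompact.exists_monotone_dual_norm_le_add (H : IsLWeaklyCompact {v}) {ε : ℝ}
    (hε : 0 < ε) : ∃ g : StrongDual ℝ E, Monotone g ∧ ∀ x ∈ Set.Icc 0 v, ‖x‖ ≤ g x + ε := by
  by_contra! hcon
  choose! F hF hF_le hF_eq using fun (x : E) (hx : 0 ≤ x) => exists_monotone_dual_eq_norm hx
  obtain ⟨q, hq, hq_lt⟩ : ∃ q : ℕ → ℕ × E,
      (∀ i, (q i).2 ∈ Set.Icc 0 v ∧ ε < ‖(q i).2‖) ∧ ∀ i j, i < j →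
        (q i).1 < (q j).1 ∧ F (q i).2 (q j).2 ≤ ‖v‖ / 2 ^ (q j).1 := by
    refine exists_seq_of_forall_finset_exists
      (fun q : ℕ × E => q.2 ∈ Set.Icc 0 v ∧ ε < ‖q.2‖)
      (fun q q' => q.1 < q'.1 ∧ F q.2 q'.2 ≤ ‖v‖ / 2 ^ q'.1) fun s hs => ?_
    obtain ⟨y, hy, hyε, hys⟩ := exists_lt_norm_forall_apply_le hε.le hcon
      (fun p hp => hF _ (hs p hp).1.1) (pow_pos two_pos (s.sup Prod.fst + 1))
    exact ⟨(_, y), ⟨hy, hyε⟩, fun p hp => ⟨Nat.lt_succ_of_le (Finset.le_sup hp), hys p hp⟩⟩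
  have hq_ge (j : ℕ) : j ≤ (q j).1 :=
    StrictMono.le_apply (f := fun i => (q i).1) fun i j hij => (hq_lt i j hij).1
  have hsum (i : ℕ) : Summable fun j => F (q i).2 (q j).2 := by
    refine (summable_geometric_two.mul_left ‖v‖).of_norm_bounded_eventually_nat ?_
    filter_upwards [eventually_gt_atTop i] with j hij
    rw [Real.norm_of_nonneg ((map_zero _).symm.trans_le (hF _ (hq i).1.1 (hq j).1.1))]
    refine (hq_lt i j hij).2.trans ?_
    rw [one_div, inv_pow, ← div_eq_mul_inv]
    gcongr
    exacts [one_le_two, hq_ge j]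
  refine hε.not_ge (ge_of_tendsto' (H.tendsto_apply_zero (fun i => (hq i).1)
    (fun i => hF _ (hq i).1.1) (fun i => hF_le _ (hq i).1.1) hsum) fun i => ?_)
  rw [hF_eq _ (hq i).1.1]
  exact (hq i).2.le

end MonotoneFunctionals

section UnboundedAbsoluteWeak

theorem isCompact_closure_of_forall_exists_tendsto_subseq {X : Type*} [PseudoMetricSpace X]
    {A : Set X} (h : ∀ x : ℕ → X, (∀ n, x n ∈ A) →
      ∃ l, ∃ ψ : ℕ → ℕ, StrictMono ψ ∧ Tendsto (x ∘ ψ) atTop (𝓝 l)) :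
    IsCompact (closure A) := by
  rw [isCompact_iff_isSeqCompact]
  intro y hy
  choose x hxA hxy using fun n : ℕ =>
    Metric.mem_closure_iff.1 (hy n) (1 / ((n : ℝ) + 1)) (by positivity)
  obtain ⟨l, ψ, hψ, hlim⟩ := h x hxA
  refine ⟨l, mem_closure_of_tendsto hlim (Eventually.of_forall fun n => hxA _), ψ, hψ, ?_⟩
  refine (tendsto_iff_of_dist ?_).2 hlim
  exact (squeeze_zero (fun n => dist_nonneg) (fun n => (hxy n).le)
    tendsto_one_div_add_atTop_nhds_zero_nat).comp hψ.tendsto_atTop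

section Definitions

variable {E : Type u} [NormedAddCommGroup E] [NormedSpace ℝ E] [Lattice E]

theorem UAWTendsto.comp {ι κ : Type*} [Preorder ι] [Preorder κ] {x : ι → E} {a : E}
    (hx : UAWTendsto x a) {φ : κ → ι} (hφ : Tendsto φ atTop atTop) : UAWTendsto (x ∘ φ) a :=
  fun w hw f => (hx w hw f).comp hφ

theorem UAWTendsto.tendsto_zero_of_norm_le {ι : Type*} [Preorder ι] {x : ι → E}
    (hx : UAWTendsto x 0) (h : ∀ ε > 0, ∃ g : StrongDual ℝ E, ∃ w : E, 0 ≤ w ∧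
      ∀ i, ‖x i‖ ≤ g (|x i| ⊓ w) + ε) : Tendsto x atTop (𝓝 0) := by
  rw [Metric.tendsto_nhds]
  intro ε hε
  obtain ⟨g, w, hw, hg⟩ := h (ε / 2) (half_pos hε)
  filter_upwards [(hx w hw g).eventually (gt_mem_nhds (half_pos hε))] with i hi
  rw [sub_zero] at hi
  rw [dist_zero_right]
  linarith [hg i]

theorem IsUAWCompact.isRelativelyUAWCompact {A : Set E} (hA : IsUAWCompact A) :
    IsRelativelyUAWCompact A :=
  ⟨hA.1, fun ι _ _ _ x hx => (hA.2 ι x hx).imp fun _ ha => ha.2⟩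

theorem HasUAWConvergentSubnet.of_frequently_eq [IsOrderedAddMonoid E] {ι : Type u} [Preorder ι]
    [IsDirectedOrder ι] [Nonempty ι] {x : ι → E} {a : E} (h : ∃ᶠ i in atTop, x i = a) :
    HasUAWConvergentSubnet x a := by
  rw [frequently_atTop] at h
  have hdir : IsDirectedOrder {i // x i = a} := ⟨fun i j => by
    obtain ⟨k, hik, hjk⟩ := exists_ge_ge i.1 j.1
    obtain ⟨l, hkl, hl⟩ := h k
    exact ⟨⟨l, hl⟩, hik.trans hkl, hjk.trans hkl⟩⟩
  have hne : Nonempty {i // x i = a} := by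
    obtain ⟨l, -, hl⟩ := h (Classical.arbitrary ι)
    exact ⟨⟨l, hl⟩⟩
  refine ⟨{i // x i = a}, inferInstance, hdir, hne, Subtype.val, tendsto_atTop.2 fun i => ?_, ?_⟩
  · obtain ⟨l, hil, hl⟩ := h i
    exact (eventually_ge_atTop ⟨l, hl⟩).mono fun j hj => hil.trans hj
  · exact fun w hw f => tendsto_const_nhds.congr fun i => by simp [i.2, hw]

theorem isUAWCompact_insert_zero_range [IsOrderedAddMonoid E] {x : ℕ → E} (hx : UAWTendsto x 0)
    (hb : Bornology.IsBounded (insert 0 (Set.range x))) :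
    IsUAWCompact (insert 0 (Set.range x)) := by
  refine ⟨hb, fun ι _ _ _ y hy => ?_⟩
  by_cases hfr : ∃ a ∈ insert 0 (Set.range x), ∃ᶠ i in atTop, y i = a
  · exact hfr.imp fun a ha => ⟨ha.1, .of_frequently_eq ha.2⟩
  simp only [not_exists, not_and, not_frequently] at hfr
  refine ⟨0, Set.mem_insert _ _, ι, inferInstance, inferInstance, inferInstance, id,
    tendsto_id, fun w hw f => ?_⟩
  rw [Metric.tendsto_nhds]
  intro ε hε
  obtain ⟨N, hN⟩ := eventually_atTop.1 (Metric.tendsto_nhds.1 (hx w hw f) ε hε)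
  have hne : ∀ᶠ i in atTop, ∀ n ∈ Finset.range N, y i ≠ x n :=
    (eventually_all_finset _).2 fun n _ =>
      hfr (x n) (Set.mem_insert_of_mem _ (Set.mem_range_self n))
  filter_upwards [hne] with i hi
  rcases hy i with h | ⟨n, hn⟩
  · simpa [h, hw] using hε
  · have hNn : N ≤ n := not_lt.1 fun hlt => hi n (Finset.mem_range.2 hlt) hn.symm
    simpa [hn] using hN n hNn

end Definitions

variable {E : Type u} [NormedAddCommGroup E] [Lattice E] [IsOrderedAddMonoid E] [HasSolidNorm E]

theorem tendsto_zero_of_disjoint_of_isCompact {K : Set E} (hK : IsCompact K) {x : ℕ → E}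
    (hxK : ∀ n, x n ∈ K) (hd : ∀ m n, m ≠ n → |x m| ⊓ |x n| = 0) : Tendsto x atTop (𝓝 0) := by
  refine tendsto_of_subseq_tendsto fun ns hns => ?_
  obtain ⟨a, -, ms, hms, ha⟩ := hK.tendsto_subseq fun n => hxK (ns n)
  have habs : Tendsto (fun n => |x (ns (ms n))|) atTop (𝓝 |a|) := ha.sup_nhds ha.neg
  have hto : Tendsto (ns ∘ ms) atTop atTop := hns.comp hms.tendsto_atTop
  have hdisj (n : ℕ) : |a| ⊓ |x n| = 0 :=
    tendsto_nhds_unique_of_eventuallyEq (habs.inf_nhds tendsto_const_nhds) tendsto_const_nhds <|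
      (hto.eventually_ne_atTop n).mono fun m hm => hd _ n hm
  have hself : |a| ⊓ |a| = 0 :=
    tendsto_nhds_unique_of_eventuallyEq (tendsto_const_nhds.inf_nhds habs) tendsto_const_nhds <|
      .of_forall fun m => hdisj (ns (ms m))
  rw [inf_idem, ← norm_eq_zero, norm_abs_eq_norm, norm_eq_zero] at hself
  exact ⟨ms, hself ▸ ha⟩

variable [NormedSpace ℝ E]

theorem summable_posPart_apply_of_pairwise_inf_eq_zero {ι : Type*} {y : ι → E} {w : E}
    (hy : ∀ i, y i ∈ Set.Icc 0 w) (hd : Pairwise fun i j => y i ⊓ y j = 0) (hw : 0 ≤ w)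
    (f : StrongDual ℝ E) : Summable fun i => (f (y i))⁺ := by
  refine summable_of_sum_le (c := ‖f‖ * ‖w‖) (fun i => posPart_nonneg _) fun s => ?_
  calc ∑ i ∈ s, (f (y i))⁺ = f (∑ i ∈ s with 0 ≤ f (y i), y i) := by
        simp only [posPart_eq_ite]
        rw [map_sum, Finset.sum_filter]
    _ ≤ ‖f‖ * ‖∑ i ∈ s with 0 ≤ f (y i), y i‖ := (le_abs_self _).trans (f.le_opNorm _)
    _ ≤ ‖f‖ * ‖w‖ := by
        gcongr
        exact norm_le_norm_of_nonneg_of_le (Finset.sum_nonneg fun i _ => (hy i).1)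
          (sum_le_of_pairwise_inf_eq_zero hy hd hw _)

theorem uawTendsto_zero_of_disjoint {x : ℕ → E} (hd : ∀ m n, m ≠ n → |x m| ⊓ |x n| = 0) :
    UAWTendsto x 0 := by
  intro w hw f
  simp only [sub_zero]
  have hy (n : ℕ) : |x n| ⊓ w ∈ Set.Icc 0 w := ⟨le_inf (abs_nonneg _) hw, inf_le_right⟩
  have hlim (g : StrongDual ℝ E) : Tendsto (fun n => (g (|x n| ⊓ w))⁺) atTop (𝓝 0) :=
    (summable_posPart_apply_of_pairwise_inf_eq_zero hy (fun m n hmn => inf_eq_zero_of_le_of_le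
      (hy m).1 (hy n).1 inf_le_left inf_le_left (hd m n hmn)) hw g).tendsto_atTop_zero
  simpa [posPart_neg, posPart_sub_negPart] using (hlim f).sub (hlim (-f))

theorem IsLwcOperator.isLWeaklyCompact {S : Set E} (hS : Bornology.IsBounded S)
    (h : IsLwcOperator S (ContinuousLinearMap.id ℝ E)) : IsLWeaklyCompact S :=
  ⟨hS, fun x hx hd => h x hx (uawTendsto_zero_of_disjoint hd)⟩

theorem isLWeaklyCompact_singleton_of_isCompact_closure
    (H : ∀ A : Set E, BddBelow A → BddAbove A → IsUAWCompact A → IsCompact (closure A)) {v : E}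
    (hv : 0 ≤ v) : IsLWeaklyCompact {v} := by
  refine ⟨Bornology.isBounded_singleton, fun x hx hd => ?_⟩
  rw [solidClosure_singleton hv] at hx
  have hsub : insert 0 (Set.range x) ⊆ Set.Icc (-v) v :=
    Set.insert_subset ⟨neg_nonpos.2 hv, hv⟩ (Set.range_subset_iff.2 hx)
  have hb : Bornology.IsBounded (insert 0 (Set.range x)) :=
    isBounded_iff_forall_norm_le.2 ⟨‖v‖, fun y hy =>
      norm_le_norm_of_abs_le_abs ((abs_le_iff_mem_Icc.2 (hsub hy)).trans (le_abs_self v))⟩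
  exact tendsto_zero_of_disjoint_of_isCompact
    (H _ (bddBelow_Icc.mono hsub) (bddAbove_Icc.mono hsub)
      (isUAWCompact_insert_zero_range (uawTendsto_zero_of_disjoint hd) hb))
    (fun n => subset_closure (Set.mem_insert_of_mem _ (Set.mem_range_self n))) hd

variable [CompleteSpace E] [IsOrderedModule ℝ E]

theorem IsLWeaklyCompact.exists_monotone_dual_norm_le_inf_add {v : E} (H : IsLWeaklyCompact {v})
    {ε : ℝ} (hε : 0 < ε) : ∃ g : StrongDual ℝ E, Monotone g ∧
      ∀ x ∈ Set.Icc (-v) v, ‖x‖ ≤ g (|x| ⊓ v) + ε := by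
  obtain ⟨g, hg, hgv⟩ := H.exists_monotone_dual_norm_le_add hε
  refine ⟨g, hg, fun x hx => ?_⟩
  have hxv : |x| ≤ v := abs_le_iff_mem_Icc.2 hx
  rw [inf_eq_left.2 hxv, ← norm_abs_eq_norm x]
  exact hgv _ ⟨abs_nonneg x, hxv⟩

theorem UAWTendsto.tendsto_of_mem_Icc (H : ∀ v : E, 0 ≤ v → IsLWeaklyCompact {v}) {ι : Type*}
    [Preorder ι] {x : ι → E} {a b l : E} (hx : ∀ i, x i ∈ Set.Icc a b) (hu : UAWTendsto x l) :
    Tendsto x atTop (𝓝 l) := by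
  let v : E := |a - l| ⊔ |b - l|
  have hv : 0 ≤ v := (abs_nonneg _).trans le_sup_left
  have hxv (i : ι) : x i - l ∈ Set.Icc (-v) v := abs_le_iff_mem_Icc.1 <| sup_le
    ((sub_le_sub_right (hx i).2 l).trans ((le_abs_self _).trans le_sup_right))
    ((neg_le_neg (sub_le_sub_right (hx i).1 l)).trans ((neg_le_abs _).trans le_sup_left))
  have hu₀ : UAWTendsto (fun i => x i - l) 0 := fun w hw f => by simpa using hu w hw f
  refine tendsto_sub_nhds_zero_iff.1 (hu₀.tendsto_zero_of_norm_le fun ε hε => ?_)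
  obtain ⟨g, -, hg⟩ := (H v hv).exists_monotone_dual_norm_le_inf_add hε
  exact ⟨g, v, hv, fun i => hg _ (hxv i)⟩

theorem HasUAWConvergentSubnet.exists_tendsto_subseq (H : ∀ v : E, 0 ≤ v → IsLWeaklyCompact {v})
    {x : ℕ → E} {a b l : E} (hx : ∀ n, x n ∈ Set.Icc a b)
    (h : HasUAWConvergentSubnet (fun n : ULift.{u} ℕ => x n.down) l) :
    ∃ ψ : ℕ → ℕ, StrictMono ψ ∧ Tendsto (x ∘ ψ) atTop (𝓝 l) := by
  obtain ⟨κ, _, _, _, φ, hφ, hu⟩ := h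
  have hdown : Tendsto (ULift.down : ULift.{u} ℕ → ℕ) atTop atTop :=
    (ULift.orderIso.{u} (α := ℕ)).tendsto_atTop
  exact (MapClusterPt.of_comp (hdown.comp hφ)
    (hu.tendsto_of_mem_Icc H fun k => hx _).mapClusterPt).tendsto_subseq

theorem IsUAWCompact.isCompact (H : ∀ v : E, 0 ≤ v → IsLWeaklyCompact {v}) {A : Set E}
    (hbelow : BddBelow A) (habove : BddAbove A) (hA : IsUAWCompact A) : IsCompact A := by
  obtain ⟨⟨a, ha⟩, ⟨b, hb⟩⟩ := And.intro hbelow habove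
  rw [isCompact_iff_isSeqCompact]
  intro x hx
  obtain ⟨l, hl, hsub⟩ := hA.2 (ULift.{u} ℕ) (fun n => x n.down) fun n => hx _
  exact ⟨l, hl, hsub.exists_tendsto_subseq H fun n => ⟨ha (hx n), hb (hx n)⟩⟩

theorem IsRelativelyUAWCompact.isCompact_closure (H : ∀ v : E, 0 ≤ v → IsLWeaklyCompact {v})
    {A : Set E} (hbelow : BddBelow A) (habove : BddAbove A) (hA : IsRelativelyUAWCompact A) :
    IsCompact (closure A) := by
  obtain ⟨⟨a, ha⟩, ⟨b, hb⟩⟩ := And.intro hbelow habove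
  refine isCompact_closure_of_forall_exists_tendsto_subseq fun x hx => ?_
  obtain ⟨l, hsub⟩ := hA.2 (ULift.{u} ℕ) (fun n => x n.down) fun n => hx _
  exact ⟨l, hsub.exists_tendsto_subseq H fun n => ⟨ha (hx n), hb (hx n)⟩⟩

end UnboundedAbsoluteWeak

theorem corollary3p13 (E : Type u) [NormedAddCommGroup E] [NormedSpace ℝ E] [CompleteSpace E]
    [Lattice E] [IsOrderedAddMonoid E] [IsOrderedModule ℝ E] [HasSolidNorm E] :
    List.TFAE [
      IsOrderContinuousLattice E,
      ∀ S : Set E, IsCompact (closure S) → IsLWeaklyCompact S,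
      ∀ v : E, 0 ≤ v → IsLwcOperator {v} (ContinuousLinearMap.id ℝ E),
      ∀ ε : ℝ, 0 < ε → ∀ v : E, 0 ≤ v →
        ∃ g : StrongDual ℝ E, (∀ x : E, 0 ≤ x → 0 ≤ g x) ∧ ∃ w : E, 0 ≤ w ∧
          ∀ x ∈ Set.Icc (-v) v, ‖x‖ ≤ g (|x| ⊓ w) + ε,
      ∀ v : E, 0 ≤ v → ∀ (ι : Type u) [Preorder ι] [IsDirectedOrder ι] [Nonempty ι] (x : ι → E),
        (∀ i, x i ∈ Set.Icc (-v) v) → UAWTendsto x 0 → Tendsto x atTop (𝓝 0),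
      ∀ v : E, 0 ≤ v → ∀ x : ℕ → E,
        (∀ n, x n ∈ Set.Icc (-v) v) → UAWTendsto x 0 → Tendsto x atTop (𝓝 0),
      ∀ A : Set E, BddBelow A → BddAbove A → IsUAWCompact A → IsCompact A,
      ∀ A : Set E, BddBelow A → BddAbove A → IsRelativelyUAWCompact A →
        IsCompact (closure A)] := by
  have hoc := isOrderContinuousLattice_iff_forall_isLWeaklyCompact_singleton (E := E)
  tfae_have 1 → 2 := fun h S hS =>
    isLWeaklyCompact_of_totallyBounded (hoc.1 h) (hS.totallyBounded.subset subset_closure)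
  tfae_have 2 → 4 := fun h ε hε v hv => by
    obtain ⟨g, hg, hgv⟩ := (h {v} (by simp)).exists_monotone_dual_norm_le_inf_add hε
    exact ⟨g, fun x hx => (map_zero g).symm.trans_le (hg hx), v, hv, hgv⟩
  tfae_have 4 → 5 := fun h v hv ι _ _ _ x hx hu => hu.tendsto_zero_of_norm_le fun ε hε => by
    obtain ⟨g, -, w, hw, hg⟩ := h ε hε v hv
    exact ⟨g, w, hw, fun i => hg _ (hx i)⟩
  tfae_have 5 → 6 := fun h v hv x hx hu =>
    let e : ULift.{u} ℕ ≃o ℕ := ULift.orderIso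
    (h v hv _ (x ∘ e) (fun i => hx (e i)) (hu.comp e.tendsto_atTop)).comp e.symm.tendsto_atTop
  tfae_have 6 → 3 := fun h v hv x hx =>
    h v hv x fun n => solidClosure_singleton hv ▸ hx n
  tfae_have 3 → 1 := fun h => hoc.2 fun v hv => (h v hv).isLWeaklyCompact (by simp)
  tfae_have 1 → 7 := fun h A hbelow habove hA => hA.isCompact (hoc.1 h) hbelow habove
  tfae_have 1 → 8 := fun h A hbelow habove hA => hA.isCompact_closure (hoc.1 h) hbelow habove
  tfae_have 7 → 1 := fun h => hoc.2 fun v =>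
    isLWeaklyCompact_singleton_of_isCompact_closure fun A hbelow habove hA =>
      (h A hbelow habove hA).closure
  tfae_have 8 → 1 := fun h => hoc.2 fun v =>
    isLWeaklyCompact_singleton_of_isCompact_closure fun A hbelow habove hA =>
      h A hbelow habove hA.isRelativelyUAWCompact
  tfae_finish
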